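/- Let $X$ be a reflexive Banach space over $\mathbb{K}\in\{\mathbb{R},\mathbb{C}\}$, with topological dual $X^*$, and let $S_E$ denote the unit sphere of a normed space $E$. The pair $(X,\mathbb{K})$ is said to have property $\mathbf{L}_{p,o}$ if for every $\varepsilon>0$ and every $x^*\in S_{X^*}$ there is $\eta(\varepsilon,x^*)>0$ such that whenever $x\in S_X$ satisfies $|x^*(x)|>1-\eta(\varepsilon,x^*)$, there is $y^*\in S_{X^*}$ with $|y^*(x)|=1$ and $\|y^*-x^*\|<\varepsilon$. A Banach space $E$ is locally uniformly rotund (LUR) if for all $x\in S_E$ and all sequences $(x_n)\subset S_E$, $\lim_n\|x_n+x\|=2$ implies $\lim_n\|x_n-x\|=0$; it is strictly convex if $\left\|\frac{x+y}{2}\right\|<1$ for all $x,y\in S_E$ with $x\neq y$. (i) If $X^*$ is LUR, then $(X,\mathbb{K})$ has $\mathbf{L}_{p,o}$. (ii) If $(X,\mathbb{K})$ has $\mathbf{L}_{p,o}$, then $X^*$ is strictly convex. -/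

import Mathlib

open Filter Topology

/-- A normed space is reflexive if the canonical embedding into its bidual is onto. -/
def IsReflexiveSpace (𝕜 X : Type*) [RCLike 𝕜] [NormedAddCommGroup X] [NormedSpace 𝕜 X] : Prop :=
  Function.Surjective (NormedSpace.inclusionInDoubleDual 𝕜 X)

/-- Locally uniformly rotund (LUR) norm. -/
def IsLUR (E : Type*) [NormedAddCommGroup E] : Prop :=
  ∀ (x : E) (u : ℕ → E), ‖x‖ = 1 → (∀ n, ‖u n‖ = 1) →
    Tendsto (fun n => ‖u n + x‖) atTop (𝓝 2) → Tendsto (fun n => ‖u n - x‖) atTop (𝓝 0)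

/-- The property `L_{p,o}` of a pair `(X, Y)`: the number `η` depends on `ε` and on the
norm-one operator `T`, and the point `x` stays fixed. -/
def HasLpo (𝕜 X Y : Type*) [RCLike 𝕜] [NormedAddCommGroup X] [NormedSpace 𝕜 X]
    [NormedAddCommGroup Y] [NormedSpace 𝕜 Y] : Prop :=
  ∀ ε : ℝ, 0 < ε → ∀ T : X →L[𝕜] Y, ‖T‖ = 1 →
    ∃ η : ℝ, 0 < η ∧ ∀ x : X, ‖x‖ = 1 → 1 - η < ‖T x‖ →
      ∃ S : X →L[𝕜] Y, ‖S‖ = 1 ∧ ‖S x‖ = 1 ∧ ‖S - T‖ < ε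

/-! (i) If `T` almost attains its norm at `x n`, a Hahn-Banach functional norming `x n`, rotated to
the phase of `T (x n)`, has a sum with `T` of norm near 2; LUR then forces it towards `T`. (ii) If
`T` is the midpoint of a segment in the dual sphere, with endpoint `u`, then `T` and `u` both equal
1 at some unit `x`. Moving from `x` along `w`, the norm grows at rate at least `re (u w)`, but
functionals near `T` norming the moved points limit the rate to about `re (T w)`. Choosing `w` with
`re ((u - T) w) > 0` is contradictory. -/

/-- A scalar `z` can be rotated onto its absolute value. -/
theorem exists_norm_one_mul_eq_norm {𝕜 : Type*} [RCLike 𝕜] (z : 𝕜) :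
    ∃ c : 𝕜, ‖c‖ = 1 ∧ c * z = (‖z‖ : 𝕜) := by
  obtain ⟨c, hc, h⟩ := RCLike.exists_norm_mul_eq_self z
  have hc0 : c ≠ 0 := by
    rintro rfl
    simp at hc
  exact ⟨c⁻¹, by simp [hc], by rw [inv_mul_eq_iff_eq_mul₀ hc0, h]⟩

section

variable {𝕜 X : Type*} [RCLike 𝕜] [NormedAddCommGroup X] [NormedSpace 𝕜 X]

/-- On a reflexive space every norm-one functional attains its norm. -/
theorem IsReflexiveSpace.exists_norm_one_apply_eq_one (hX : IsReflexiveSpace 𝕜 X)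
    (T : StrongDual 𝕜 X) (hT : ‖T‖ = 1) : ∃ x : X, ‖x‖ = 1 ∧ T x = 1 := by
  obtain ⟨g, hg, hgT⟩ := exists_dual_vector 𝕜 T (by rw [← norm_ne_zero_iff, hT]; norm_num)
  obtain ⟨x, rfl⟩ := hX g
  refine ⟨x, ?_, by simpa [hT] using hgT⟩
  rw [← hg]
  exact ((NormedSpace.inclusionInDoubleDualLi 𝕜).norm_map x).symm

/-- If the dual of `X` is locally uniformly rotund, then `(X, 𝕜)` has `L_{p,o}`. -/
theorem IsLUR.hasLpo (h : IsLUR (StrongDual 𝕜 X)) : HasLpo 𝕜 X 𝕜 := by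
  intro ε hε T hT
  by_contra! hcon
  choose x hx hTx hfar using fun n : ℕ => hcon (1 / ((n : ℝ) + 1)) Nat.one_div_pos_of_nat
  have hS : ∀ n, ∃ S : StrongDual 𝕜 X, ‖S‖ = 1 ∧ ‖S (x n)‖ = 1 ∧ 1 + ‖T (x n)‖ ≤ ‖S + T‖ := by
    intro n
    obtain ⟨g, hg, hgx⟩ := exists_dual_vector 𝕜 (x n) (by rw [← norm_ne_zero_iff, hx]; norm_num)
    rw [hx, RCLike.ofReal_one] at hgx
    obtain ⟨c, hc, hcT⟩ := exists_norm_one_mul_eq_norm (T (x n))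
    have hc0 : c ≠ 0 := by
      rintro rfl
      simp at hc
    refine ⟨c⁻¹ • g, by simp [norm_smul, hc, hg], by simp [hgx, hc], ?_⟩
    have h1 : c * ((c⁻¹ • g + T) (x n)) = ((1 + ‖T (x n)‖ : ℝ) : 𝕜) := by
      simp [mul_add, hgx, hcT, hc0]
    calc 1 + ‖T (x n)‖ = ‖c * ((c⁻¹ • g + T) (x n))‖ := by
          rw [h1, RCLike.norm_of_nonneg (by positivity)]
      _ = ‖(c⁻¹ • g + T) (x n)‖ := by rw [norm_mul, hc, one_mul]
      _ ≤ ‖c⁻¹ • g + T‖ := by simpa [hx] using (c⁻¹ • g + T).le_opNorm (x n)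
  choose S hS1 hSx hST using hS
  have hlim : Tendsto (fun n => ‖S n + T‖) atTop (𝓝 2) := by
    have hlow : Tendsto (fun n : ℕ => 2 - 1 / ((n : ℝ) + 1)) atTop (𝓝 2) := by
      simpa using tendsto_one_div_add_atTop_nhds_zero_nat.const_sub (2 : ℝ)
    refine tendsto_of_tendsto_of_tendsto_of_le_of_le hlow tendsto_const_nhds ?_ ?_
    · intro n
      have := hST n
      have := hTx n
      dsimp only
      linarith
    · intro n
      have := norm_add_le (S n) T
      rw [hS1, hT] at this
      dsimp only
      linarith
  have h0 := h T S hT hS1 hlim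
  obtain ⟨n, hn⟩ := (h0.eventually_lt_const hε).exists
  exact absurd hn (not_lt.mpr (hfar n (S n) (hS1 n) (hSx n)))

/-- A nonzero functional has positive real part at some unit vector. -/
theorem exists_norm_one_re_apply_pos {h : StrongDual 𝕜 X} (hh : h ≠ 0) :
    ∃ w : X, ‖w‖ = 1 ∧ 0 < RCLike.re (h w) := by
  obtain ⟨v, hv⟩ := DFunLike.ne_iff.mp hh
  have hv0 : v ≠ 0 := by
    rintro rfl
    simp at hv
  obtain ⟨c, hc, hcv⟩ := exists_norm_one_mul_eq_norm (h v)
  refine ⟨((‖v‖⁻¹ : ℝ) : 𝕜) • c • v, ?_, ?_⟩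
  · simp [norm_smul, hc, hv0]
  · rw [h.map_smul, h.map_smul, smul_eq_mul, smul_eq_mul, hcv, ← RCLike.ofReal_mul, RCLike.ofReal_re]
    exact mul_pos (inv_pos.mpr (norm_pos_iff.mpr hv0)) (norm_pos_iff.mpr hv)

/-- If a norm-one functional `S` attains its norm at the perturbation `x + δ w` of a unit vector
`x` at which `T` is `1`, then the norm of `x + δ w` grows in `δ` at most like `re (T w)`, up to an
error controlled by `δ` and by the distance of `S` to `T`. -/
theorem norm_add_smul_le_of_norm_apply_eq {S T : StrongDual 𝕜 X} {x w : X} {δ ε : ℝ}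
    (hS : ‖S‖ = 1) (hx : ‖x‖ = 1) (hw : ‖w‖ = 1) (hTx : T x = 1) (hδ : 0 < δ) (hδ' : δ ≤ 1 / 2)
    (hST : ‖S - T‖ ≤ ε) (hSx : ‖S (x + (δ : 𝕜) • w)‖ = ‖x + (δ : 𝕜) • w‖) :
    ‖x + (δ : 𝕜) • w‖ ≤ 1 + δ * (RCLike.re (T w) + 3 * ε + 4 * δ) := by
  set z := x + (δ : 𝕜) • w with hz
  have hδw : ‖(δ : 𝕜) • w‖ = δ := by
    rw [norm_smul, RCLike.norm_of_nonneg hδ.le, hw, mul_one]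
  have hz1 : |‖z‖ - 1| ≤ δ := by
    have := abs_norm_sub_norm_le z x
    rwa [hx, hz, add_sub_cancel_left, hδw] at this
  have hzlow : 1 / 2 ≤ ‖z‖ := by linarith [(abs_le.mp hz1).1]
  have hunit : ∀ (R : StrongDual 𝕜 X) (y : X), ‖y‖ = 1 → ‖R y‖ ≤ ‖R‖ := fun R y hy => by
    simpa [hy] using R.le_opNorm y
  obtain ⟨c, hc, hcz⟩ := exists_norm_one_mul_eq_norm (S z)
  rw [hSx] at hcz
  have hexp : S z = S x + (δ : 𝕜) * S w := by simp [hz]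
  -- The phase `c` is near 1, since `S z` and `‖z‖` are both near `T x = 1`.
  have hc1 : ‖c - 1‖ * ‖z‖ ≤ 2 * δ + ε := by
    have e : (c - 1) * S z =
        ((‖z‖ - 1 : ℝ) : 𝕜) + (-((S - T) x) - (δ : 𝕜) * S w) := by
      rw [sub_mul, hcz, hexp]
      simp [hTx]
      ring
    rw [← hSx, ← norm_mul, e]
    have h1 : ‖((‖z‖ - 1 : ℝ) : 𝕜)‖ ≤ δ := by rwa [RCLike.norm_ofReal]
    have h2 : ‖-((S - T) x)‖ ≤ ε := by
      rw [norm_neg]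
      exact (hunit _ x hx).trans hST
    have h3 : ‖(δ : 𝕜) * S w‖ ≤ δ := by
      rw [norm_mul, RCLike.norm_of_nonneg hδ.le]
      exact mul_le_of_le_one_right hδ.le ((hunit S w hw).trans_eq hS)
    linarith [norm_add_le ((‖z‖ - 1 : ℝ) : 𝕜) (-((S - T) x) - (δ : 𝕜) * S w),
      norm_sub_le (-((S - T) x)) ((δ : 𝕜) * S w)]
  have hc2 : ‖c - 1‖ ≤ 4 * δ + 2 * ε := by nlinarith [norm_nonneg (c - 1)]
  have hre : ‖z‖ = RCLike.re (c * S x) + δ * RCLike.re (c * S w) := by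
    rw [← RCLike.re_ofReal_mul, ← map_add, mul_left_comm, ← mul_add, ← hexp, hcz,
      RCLike.ofReal_re]
  have hcx : RCLike.re (c * S x) ≤ 1 := by
    refine (RCLike.re_le_norm _).trans ?_
    rw [norm_mul, hc, one_mul]
    exact (hunit S x hx).trans_eq hS
  have hcw : RCLike.re (c * S w) ≤ RCLike.re (T w) + 3 * ε + 4 * δ := by
    have e : c * S w = T w + ((S - T) w + (c - 1) * S w) := by
      simp only [sub_apply]
      ring
    have h1 : ‖(S - T) w‖ ≤ ε := (hunit _ w hw).trans hST
    have h2 : ‖(c - 1) * S w‖ ≤ 4 * δ + 2 * ε := by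
      rw [norm_mul]
      exact (mul_le_of_le_one_right (norm_nonneg _) ((hunit S w hw).trans_eq hS)).trans hc2
    rw [e, map_add, map_add]
    linarith [RCLike.re_le_norm ((S - T) w), RCLike.re_le_norm ((c - 1) * S w)]
  rw [hre]
  exact add_le_add hcx (mul_le_mul_of_nonneg_left hcw hδ.le)

/-- If `X` is reflexive and `(X, 𝕜)` has `L_{p,o}`, then the dual of `X` is strictly convex. -/
theorem HasLpo.strictConvexSpace (hX : IsReflexiveSpace 𝕜 X) (h : HasLpo 𝕜 X 𝕜) :
    StrictConvexSpace ℝ (StrongDual 𝕜 X) := by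
  refine StrictConvexSpace.of_norm_add_ne_two fun u v hu hv huv hadd => ?_
  set T : StrongDual 𝕜 X := (2 : 𝕜)⁻¹ • (u + v) with hTdef
  set d : StrongDual 𝕜 X := u - T with hd
  have hT : ‖T‖ = 1 := by rw [hTdef, norm_smul, hadd]; simp
  have hd0 : d ≠ 0 := by
    intro h0
    apply huv
    have e : u = (2 : 𝕜)⁻¹ • (u + v) := sub_eq_zero.mp h0
    rw [eq_inv_smul_iff₀ two_ne_zero, two_smul 𝕜 u] at e
    exact add_left_cancel e
  obtain ⟨x, hx, hTx⟩ := hX.exists_norm_one_apply_eq_one T hT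
  obtain ⟨w, hw, hdw⟩ := exists_norm_one_re_apply_pos hd0
  set κ := RCLike.re (d w) with hκ
  have hunit : ∀ (R : StrongDual 𝕜 X) (y : X), ‖y‖ = 1 → ‖R y‖ ≤ ‖R‖ := fun R y hy => by
    simpa [hy] using R.le_opNorm y
  have hux : 1 ≤ RCLike.re (u x) := by
    have e : u x + v x = 2 := by
      have : (2 : 𝕜)⁻¹ * (u x + v x) = 1 := by simpa [hTdef, mul_add] using hTx
      rwa [inv_mul_eq_iff_eq_mul₀ two_ne_zero, mul_one] at this
    have e' := congrArg RCLike.re e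
    rw [map_add, RCLike.ofNat_re] at e'
    linarith [(RCLike.re_le_norm (v x)).trans (hunit v x hx)]
  -- With `16 * δ ≤ κ`, the total error `3 * (κ / 8) + 4 * δ` is at most `5 * κ / 8 < κ`.
  obtain ⟨η, hη, hLpo⟩ := h (κ / 8) (by positivity) T hT
  obtain ⟨δ, hδ, hδη, hδκ, hδ1⟩ : ∃ δ : ℝ, 0 < δ ∧ 2 * δ < η ∧ 16 * δ ≤ κ ∧ δ ≤ 1 / 2 := by
    refine ⟨min (η / 4) (min (κ / 16) (1 / 2)), by positivity, ?_, ?_, ?_⟩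
    · linarith [min_le_left (η / 4) (min (κ / 16) (1 / 2))]
    · linarith [(min_le_right (η / 4) (min (κ / 16) (1 / 2))).trans (min_le_left _ _)]
    · exact (min_le_right _ _).trans (min_le_right _ _)
  set z := x + (δ : 𝕜) • w with hz
  have hδw : ‖(δ : 𝕜) • w‖ = δ := by
    rw [norm_smul, RCLike.norm_of_nonneg hδ.le, hw, mul_one]
  have hz1 : ‖z‖ ≤ 1 + δ := by
    have := norm_add_le x ((δ : 𝕜) • w)
    rwa [hx, hδw] at this
  have hz0 : 0 < ‖z‖ := by
    have := norm_sub_le_norm_add x ((δ : 𝕜) • w)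
    rw [hx, hδw, ← hz] at this
    linarith
  have hTz : 1 - δ ≤ ‖T z‖ := by
    have e : T z = 1 + T ((δ : 𝕜) • w) := by rw [hz, map_add, hTx]
    have h1 : ‖T ((δ : 𝕜) • w)‖ ≤ δ := by
      have := T.le_opNorm ((δ : 𝕜) • w)
      rwa [hT, one_mul, hδw] at this
    have := norm_sub_le_norm_add (1 : 𝕜) (T ((δ : 𝕜) • w))
    rw [norm_one, ← e] at this
    linarith
  have hnorm : ∀ R : StrongDual 𝕜 X, ‖R (((‖z‖⁻¹ : ℝ) : 𝕜) • z)‖ = ‖R z‖ / ‖z‖ := fun R => by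
    rw [map_smul, norm_smul, RCLike.norm_of_nonneg (inv_nonneg.mpr hz0.le), inv_mul_eq_div]
  obtain ⟨S, hS, hSz, hST⟩ := hLpo (((‖z‖⁻¹ : ℝ) : 𝕜) • z)
    (by rw [norm_smul, RCLike.norm_of_nonneg (inv_nonneg.mpr hz0.le), inv_mul_cancel₀ hz0.ne'])
    (by
      rw [hnorm, lt_div_iff₀ hz0]
      refine lt_of_lt_of_le ?_ hTz
      -- For `η ≤ 1`, `2 * δ < η` gives `(1 - η) * (1 + δ) < 1 - δ`; otherwise the left side is
      -- nonpositive.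
      rcases le_total η 1 with h1 | h1 <;> nlinarith)
  rw [hnorm, div_eq_one_iff_eq hz0.ne'] at hSz
  have hup := norm_add_smul_le_of_norm_apply_eq hS hx hw hTx hδ hδ1 hST.le hSz
  have hlow : 1 + δ * (RCLike.re (T w) + κ) ≤ ‖z‖ := by
    have e : RCLike.re (u z) = RCLike.re (u x) + δ * (RCLike.re (T w) + κ) := by
      rw [hκ, ← map_add, hd, sub_apply, add_sub_cancel, ← RCLike.re_ofReal_mul,
        ← map_add, hz, map_add, map_smul, smul_eq_mul]
    have h1 : RCLike.re (u z) ≤ ‖z‖ := by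
      have := u.le_opNorm z
      rw [hu, one_mul] at this
      exact (RCLike.re_le_norm _).trans this
    linarith
  have hcomp : RCLike.re (T w) + κ ≤ RCLike.re (T w) + 3 * (κ / 8) + 4 * δ :=
    le_of_mul_le_mul_left (by linarith) hδ
  linarith

end

theorem corollary2p2 {𝕜 : Type*} [RCLike 𝕜] {X : Type*} [NormedAddCommGroup X] [NormedSpace 𝕜 X]
    [CompleteSpace X] (hX : IsReflexiveSpace 𝕜 X) :
    (IsLUR (StrongDual 𝕜 X) → HasLpo 𝕜 X 𝕜) ∧
      (HasLpo 𝕜 X 𝕜 → StrictConvexSpace ℝ (StrongDual 𝕜 X)) :=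
  ⟨IsLUR.hasLpo, HasLpo.strictConvexSpace hX⟩
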